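/- Let $s>2$ be an integer and $A=\{0,1,\dots,s-1\}$. For a sequence $(d_k)_{k\ge1}$ in $A$ write $\Delta^s_{d_1d_2\dots}=\sum_{k\ge1}d_ks^{-k}$. For $u\in A$ let $$\mathbb S_{(s,u)}=\Bigl\{\Delta^s_{\underbrace{u\dots u}_{\alpha_1-1}\alpha_1\underbrace{u\dots u}_{\alpha_2-1}\alpha_2\dots\underbrace{u\dots u}_{\alpha_n-1}\alpha_n\dots}\;:\;\alpha_n\in A\setminus\{0,u\}\text{ for all }n\ge1\Bigr\},\qquad \mathbb S_0=\bigcup_{u=0}^{s-1}\mathbb S_{(s,u)}.$$ Call $x\in[0,1]$ a normal number in base $s$ if it has a base-$s$ expansion $x=\Delta^s_{d_1d_2\dots}$ in which every digit $i\in A$ has frequency $1/s$, that is, $\lim_{k\to\infty}\frac1k\#\{j\le k: d_j=i\}=\frac1s$. (A number with two base-$s$ expansions is not normal with respect to either of them.) Then: - if $s=3$, the set of normal numbers in base $3$ that belong to $\mathbb S_0$ has the cardinality of the continuum, is a subset of $\mathbb S_{(3,0)}$, and its Hausdorff dimension $\alpha_0$ satisfies $$\tfrac13\log_3 2\;\le\;\alpha_0\;\le\;\log_3\frac{2}{\sqrt5-1};$$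 - if $s\neq3$ (that is, $s>3$), the set of normal numbers in base $s$ that belong to $\mathbb S_0$ is empty. -/

import Mathlib

open Filter Topology

noncomputable section

namespace SAdic

/-- The digit sequence `d` (indexed from `0`) is the concatenation of the blocks
`u … u αₙ` (`αₙ - 1` copies of `u`, then `αₙ`), `n = 0, 1, 2, …`.
The block of `αₙ` has length `αₙ`, so `αₙ` itself stands at the place (counted from `1`) with
number `α₀ + … + αₙ`; every other place holds `u`. -/
def IsBlockConcat {s : ℕ} (u : Fin s) (α : ℕ → Fin s) (d : ℕ → Fin s) : Prop :=
  (∀ n k : ℕ, k + 1 = ∑ i ∈ Finset.range (n + 1), (α i : ℕ) → d k = α n) ∧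
  (∀ k : ℕ, (∀ n : ℕ, k + 1 ≠ ∑ i ∈ Finset.range (n + 1), (α i : ℕ)) → d k = u)

/-- The set of the numbers whose base-`s` expansion is a concatenation of blocks `u … u αₙ`
as above, for some sequence of digits `αₙ` different from `0` and from `u`. -/
def S (s : ℕ) (u : Fin s) : Set ℝ :=
  {x | ∃ α d : ℕ → Fin s, (∀ n, (α n : ℕ) ≠ 0 ∧ α n ≠ u) ∧ IsBlockConcat u α d ∧
    x = Real.ofDigits d}

/-- The union of the sets `S s u` over all digits `u`. -/
def S₀ (s : ℕ) : Set ℝ := ⋃ u : Fin s, S s u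

/-- The number of occurrences of the digit `i` among the first `k` digits of `d`. -/
def digitCount {s : ℕ} (d : ℕ → Fin s) (i : Fin s) (k : ℕ) : ℕ :=
  ((Finset.range k).filter (fun j => d j = i)).card

/-- The digit `i` has frequency `v` in the digit sequence `d`. -/
def HasFrequency {s : ℕ} (d : ℕ → Fin s) (i : Fin s) (v : ℝ) : Prop :=
  Tendsto (fun k : ℕ => (digitCount d i k : ℝ) / (k : ℝ)) atTop (𝓝 v)

/-- The normal numbers in base `s`: the numbers of `[0, 1]` in whose base-`s` expansion every
digit has frequency `1 / s`. (A number with two expansions has in both of them a digit of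
frequency `1`, so for `s ≥ 2` the choice of the expansion is immaterial.) -/
def normalNumbers (s : ℕ) : Set ℝ :=
  {x | x ∈ Set.Icc (0 : ℝ) 1 ∧
    ∃ d : ℕ → Fin s, x = Real.ofDigits d ∧ ∀ i : Fin s, HasFrequency d i ((s : ℝ)⁻¹)}

end SAdic

end

/-!
A normal expansion takes every digit infinitely often, so it is the only expansion of its number.
A concatenation of blocks `u … u αₙ` contains the digit `0` only if `u = 0`, and then every block
has a digit sum equal to its length. The mean of the digits up to the end of a block is therefore
`1`, whereas normality forces the limit `(s - 1) / 2`; hence `s = 3`.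

A block `0 … 0 a` contracts by the factor `s⁻ᵃ`. For `s = 3` the labels are `1` and `2`, and
`3⁻ᵗ + 3⁻²ᵗ = 1` holds exactly when `3ᵗ` is the golden ratio, which gives the upper bound for the
dimension. For the lower bound, the words `021 = 0 2 | 1` and `102 = 1 | 0 2` may be concatenated in
any order: each contains every digit once, and as digits in base `27` they are `7` and `11`, which
are so far apart that the coding by binary sequences has a Hölder inverse with exponent `log₂₇ 2`.
-/

namespace SAdic

/-! ### Base-`b` expansions -/

section Expansion

variable {b : ℕ} {d e : ℕ → Fin b}

lemma ofDigits_sub_ofDigits {n : ℕ} (h : ∀ i < n, d i = e i) :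
    Real.ofDigits d - Real.ofDigits e =
      ((d n - e n : ℝ) + (Real.ofDigits (fun i => d (i + (n + 1))) -
        Real.ofDigits (fun i => e (i + (n + 1))))) / (b : ℝ) ^ (n + 1) := by
  have hsum : ∑ i ∈ Finset.range n, Real.ofDigitsTerm d i =
      ∑ i ∈ Finset.range n, Real.ofDigitsTerm e i :=
    Finset.sum_congr rfl fun i hi => by
      rw [Real.ofDigitsTerm, Real.ofDigitsTerm, h i (Finset.mem_range.mp hi)]
  rw [Real.ofDigits_eq_sum_add_ofDigits d (n + 1), Real.ofDigits_eq_sum_add_ofDigits e (n + 1),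
    Finset.sum_range_succ, Finset.sum_range_succ, hsum, Real.ofDigitsTerm, Real.ofDigitsTerm]
  ring

lemma abs_ofDigits_sub_ofDigits_le_one : |Real.ofDigits d - Real.ofDigits e| ≤ 1 := by
  simpa using Real.abs_ofDigits_sub_ofDigits_le (x := d) (y := e) (n := 0) (by simp)

lemma abs_sub_sub_one_div_pow_le {n : ℕ} (h : ∀ i < n, d i = e i) :
    (|(d n - e n : ℝ)| - 1) / (b : ℝ) ^ (n + 1) ≤ |Real.ofDigits d - Real.ofDigits e| := by
  rw [ofDigits_sub_ofDigits h, abs_div, abs_of_nonneg (by positivity : (0 : ℝ) ≤ b ^ (n + 1))]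
  gcongr
  have htail := abs_ofDigits_sub_ofDigits_le_one (d := fun i => d (i + (n + 1)))
    (e := fun i => e (i + (n + 1)))
  refine (sub_le_sub_left htail _).trans ?_
  simpa only [abs_neg, sub_neg_eq_add] using abs_sub_abs_le_abs_sub (d n - e n : ℝ)
    (-(Real.ofDigits (fun i => d (i + (n + 1))) - Real.ofDigits fun i => e (i + (n + 1))))

lemma ofDigits_pos {k : ℕ} (hk : (d k : ℕ) ≠ 0) : 0 < Real.ofDigits d := by
  have hb : 0 < b := Fin.pos (d 0)
  exact Real.summable_ofDigitsTerm.tsum_pos (fun _ => Real.ofDigitsTerm_nonneg) k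
    (mul_pos (by exact_mod_cast Nat.pos_of_ne_zero hk) (by positivity))

lemma ofDigits_lt_one (hb : 1 < b) {k : ℕ} (hk : (d k : ℕ) ≠ b - 1) : Real.ofDigits d < 1 := by
  rw [← Real.ofDigits_const_last_eq_one' hb]
  have hle : ∀ i, (d i : ℕ) ≤ b - 1 := fun i => Nat.le_sub_one_of_lt (d i).isLt
  refine Summable.tsum_lt_tsum (i := k) (fun i => ?_) ?_ Real.summable_ofDigitsTerm
    Real.summable_ofDigitsTerm
  · exact mul_le_mul_of_nonneg_right (Nat.cast_le.mpr (hle i)) (by positivity)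
  · exact mul_lt_mul_of_pos_right (Nat.cast_lt.mpr ((hle k).lt_of_ne hk)) (by positivity)

lemma ofDigits_mem_Ioo (hd : ∀ c, ∃ k, d k ≠ c) : Real.ofDigits d ∈ Set.Ioo 0 1 := by
  obtain ⟨k, hk⟩ := hd (d 0)
  have hb : 1 < b := Fin.nontrivial_iff_two_le.mp ⟨_, _, hk⟩
  obtain ⟨i, hi⟩ := hd ⟨0, by omega⟩
  obtain ⟨j, hj⟩ := hd ⟨b - 1, by omega⟩
  exact ⟨ofDigits_pos fun h => hi (Fin.ext h), ofDigits_lt_one hb fun h => hj (Fin.ext h)⟩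

lemma eq_of_ofDigits_eq (hd : ∀ c, ∃ᶠ k in atTop, d k ≠ c)
    (h : Real.ofDigits d = Real.ofDigits e) : d = e := by
  by_contra hne
  set n := PiNat.firstDiff d e
  have hsub := ofDigits_sub_ofDigits (n := n) fun _ =>
    PiNat.apply_eq_of_lt_firstDiff (E := fun _ => Fin b)
  have hb : (0 : ℝ) < b := by exact_mod_cast Fin.pos (d 0)
  rw [h, sub_self, eq_comm, div_eq_zero_iff, or_iff_left (by positivity)] at hsub
  have htd : Real.ofDigits (fun i => d (i + (n + 1))) ∈ Set.Ioo (0 : ℝ) 1 :=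
    ofDigits_mem_Ioo fun c => by
      obtain ⟨k, hk, hkc⟩ := frequently_atTop.mp (hd c) (n + 1)
      exact ⟨k - (n + 1), by rwa [Nat.sub_add_cancel hk]⟩
  have hte := Real.ofDigits_nonneg fun i => e (i + (n + 1))
  have hte' := Real.ofDigits_le_one fun i => e (i + (n + 1))
  have hlt : |((d n : ℤ) - (e n : ℤ) : ℝ)| < 1 := by
    push_cast
    rw [abs_lt]
    constructor <;> linarith [htd.1, htd.2]
  have hdigit : (d n : ℤ) - (e n : ℤ) = 0 := Int.abs_lt_one_iff.mp (by exact_mod_cast hlt)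
  have hdn : d n = e n := Fin.ext (by omega)
  exact PiNat.apply_firstDiff_ne hne hdn

end Expansion

/-! ### Frequencies -/

section Frequency

variable {s : ℕ} {d e : ℕ → Fin s}

lemma digitCount_mono (d : ℕ → Fin s) (i : Fin s) : Monotone (digitCount d i) :=
  fun _ _ h => Finset.card_le_card
    (Finset.filter_subset_filter _ (Finset.range_subset_range.mpr h))

lemma HasFrequency.frequently_eq {i : Fin s} {v : ℝ} (h : HasFrequency d i v) (hv : v ≠ 0) :
    ∃ᶠ k in atTop, d k = i := by
  intro hne
  obtain ⟨N, hN⟩ := eventually_atTop.mp hne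
  have hle : ∀ k, digitCount d i k ≤ N := fun k =>
    (Finset.card_le_card fun j hj => by
      by_contra hjN
      exact hN j (by simpa using hjN) (Finset.mem_filter.mp hj).2).trans_eq (Finset.card_range N)
  refine hv (tendsto_nhds_unique h (squeeze_zero (fun k => by positivity) (fun k => ?_)
    (tendsto_const_div_atTop_nhds_zero_nat (N : ℝ))))
  gcongr
  exact hle k

lemma tendsto_average_of_hasFrequency {v : Fin s → ℝ} (h : ∀ i, HasFrequency d i (v i))
    (f : Fin s → ℝ) :
    Tendsto (fun k : ℕ => (∑ j ∈ Finset.range k, f (d j)) / k) atTop (𝓝 (∑ i, f i * v i)) := by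
  refine (tendsto_finsetSum Finset.univ fun i _ => (h i).const_mul (f i)).congr fun k => ?_
  have hfiber : ∑ j ∈ Finset.range k, f (d j) = ∑ i, f i * digitCount d i k := by
    rw [← Finset.sum_fiberwise (Finset.range k) d]
    refine Finset.sum_congr rfl fun i _ => ?_
    rw [Finset.sum_congr rfl fun j hj => by rw [(Finset.mem_filter.mp hj).2], Finset.sum_const,
      nsmul_eq_mul, mul_comm, digitCount]
  rw [hfiber, Finset.sum_div]
  simp only [mul_div_assoc]

lemma hasFrequency_of_digitCount_mul {m c : ℕ} (hm : 0 < m) {i : Fin s}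
    (h : ∀ n, digitCount d i (m * n) = c * n) : HasFrequency d i (c / m) := by
  rw [HasFrequency, tendsto_iff_dist_tendsto_zero]
  refine squeeze_zero' (.of_forall fun k => dist_nonneg) ?_
    (tendsto_const_div_atTop_nhds_zero_nat (c : ℝ))
  filter_upwards [eventually_gt_atTop 0] with k hk
  have hlower : (c * (k / m : ℕ) : ℝ) ≤ digitCount d i k := by
    exact_mod_cast h (k / m) ▸ digitCount_mono d i (Nat.mul_div_le k m)
  have hupper : (digitCount d i k : ℝ) ≤ c * ((k / m : ℕ) + 1) := by
    exact_mod_cast h (k / m + 1) ▸ digitCount_mono d i (Nat.lt_mul_div_succ k hm).le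
  have hfloor : ((k / m : ℕ) : ℝ) ≤ k / m := Nat.cast_div_le
  have hceil : (k / m : ℝ) ≤ (k / m : ℕ) + 1 := by
    rw [div_le_iff₀' (by exact_mod_cast hm)]
    exact_mod_cast (Nat.lt_mul_div_succ k hm).le
  have hk' : (0 : ℝ) < k := by exact_mod_cast hk
  have hdiff : (digitCount d i k : ℝ) / k - c / m = (digitCount d i k - c * (k / m)) / k := by
    field_simp
  rw [Real.dist_eq, hdiff, abs_div, abs_of_pos hk']
  gcongr
  rw [abs_le]
  constructor <;> nlinarith

lemma eq_of_ofDigits_eq_of_hasFrequency (hs : 1 < s)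
    (hd : ∀ i, HasFrequency d i ((s : ℝ)⁻¹)) (h : Real.ofDigits d = Real.ofDigits e) :
    d = e := by
  refine eq_of_ofDigits_eq (fun c => ?_) h
  have : Nontrivial (Fin s) := Fin.nontrivial_iff_two_le.mpr hs
  obtain ⟨i, hi⟩ := exists_ne c
  exact ((hd i).frequently_eq (by positivity)).mono fun k hk => hk ▸ hi

end Frequency

/-! ### Concatenations of blocks -/

/-- The total length of the first `n` blocks, when the block of `α i` has length `α i`. -/
def blockEnd {s : ℕ} (α : ℕ → Fin s) (n : ℕ) : ℕ := ∑ i ∈ Finset.range n, (α i : ℕ)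

lemma blockEnd_succ {s : ℕ} (α : ℕ → Fin s) (n : ℕ) :
    blockEnd α (n + 1) = blockEnd α n + α n := Finset.sum_range_succ _ _

lemma blockEnd_strictMono {s : ℕ} {α : ℕ → Fin s} (hα : ∀ n, (α n : ℕ) ≠ 0) :
    StrictMono (blockEnd α) := strictMono_nat_of_lt_succ fun n => by
  rw [blockEnd_succ]
  exact Nat.lt_add_of_pos_right (Nat.pos_of_ne_zero (hα n))

namespace IsBlockConcat

variable {s : ℕ} {u : Fin s} {α d : ℕ → Fin s}

lemma apply_of_succ_eq (h : IsBlockConcat u α d) {n k : ℕ} (hk : k + 1 = blockEnd α (n + 1)) :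
    d k = α n := h.1 n k hk

lemma apply_of_lt (h : IsBlockConcat u α d) (hα : ∀ n, (α n : ℕ) ≠ 0) {n k : ℕ}
    (hk : blockEnd α n ≤ k) (hk' : k + 1 < blockEnd α (n + 1)) : d k = u := by
  refine h.2 k fun m (hm : k + 1 = blockEnd α (m + 1)) => ?_
  have hmn : m + 1 < n + 1 := (blockEnd_strictMono hα).lt_iff_lt.mp (hm ▸ hk')
  have hnm : n < m + 1 := (blockEnd_strictMono hα).lt_iff_lt.mp (hm ▸ Nat.lt_add_one_of_le hk)
  omega

lemma val_eq_zero (h : IsBlockConcat u α d) (hα : ∀ n, (α n : ℕ) ≠ 0) {k : ℕ}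
    (hk : (d k : ℕ) = 0) : (u : ℕ) = 0 := by
  by_cases hlast : ∃ n, k + 1 = blockEnd α (n + 1)
  · obtain ⟨n, hn⟩ := hlast
    exact absurd (h.apply_of_succ_eq hn ▸ hk) (hα n)
  · exact h.2 k (not_exists.mp hlast) ▸ hk

lemma sum_range_blockEnd (h : IsBlockConcat u α d) (hα : ∀ n, (α n : ℕ) ≠ 0) (n : ℕ) :
    ∑ k ∈ Finset.range (blockEnd α n), (d k : ℕ) + n * u = (u + 1) * blockEnd α n := by
  induction n with
  | zero => simp [blockEnd]
  | succ n ih =>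
    obtain ⟨a, ha⟩ := Nat.exists_eq_add_one_of_ne_zero (hα n)
    have hend : blockEnd α (n + 1) = blockEnd α n + a + 1 := by rw [blockEnd_succ, ha, add_assoc]
    have hlast : d (blockEnd α n + a) = α n := h.apply_of_succ_eq hend.symm
    have hfill : ∑ k ∈ Finset.range a, (d (blockEnd α n + k) : ℕ) = a * u := by
      refine (Finset.sum_const_nat fun k hk => ?_).trans (by rw [Finset.card_range])
      rw [Finset.mem_range] at hk
      rw [h.apply_of_lt hα (n := n) (by omega) (by omega)]
    rw [hend, Finset.sum_range_succ, Finset.sum_range_add, hfill, hlast, ha]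
    linear_combination ih

lemma apply_eq_of_lt_blockEnd {β e : ℕ → Fin s} (h : IsBlockConcat u α d) (h' : IsBlockConcat u β e)
    (hα : ∀ n, (α n : ℕ) ≠ 0) (hβ : ∀ n, (β n : ℕ) ≠ 0) {n : ℕ} (hαβ : ∀ i < n, α i = β i) :
    ∀ k < blockEnd α n, d k = e k := by
  induction n with
  | zero => simp [blockEnd]
  | succ n ih =>
    intro k hk
    have hend : ∀ m ≤ n + 1, blockEnd α m = blockEnd β m := fun m hm =>
      Finset.sum_congr rfl fun i hi => by
        rw [hαβ i ((Finset.mem_range.mp hi).trans_le hm)]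
    rcases lt_or_ge k (blockEnd α n) with hlt | hge
    · exact ih (fun i hi => hαβ i (by omega)) k hlt
    · rcases (Nat.succ_le_of_lt hk).lt_or_eq with hk' | hk'
      · rw [h.apply_of_lt hα hge hk',
          h'.apply_of_lt hβ (hend n (by omega) ▸ hge) (hend (n + 1) le_rfl ▸ hk')]
      · rw [h.apply_of_succ_eq hk', h'.apply_of_succ_eq ((hend (n + 1) le_rfl) ▸ hk'),
          hαβ n (by omega)]

lemma eq_three_of_hasFrequency (h : IsBlockConcat u α d) (hα : ∀ n, (α n : ℕ) ≠ 0)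
    (hu : (u : ℕ) = 0) (hd : ∀ i, HasFrequency d i ((s : ℝ)⁻¹)) : s = 3 := by
  have hs : (s : ℝ) ≠ 0 := by exact_mod_cast (Fin.pos u).ne'
  have hmean := (tendsto_average_of_hasFrequency hd fun i => (i : ℝ)).comp
    (blockEnd_strictMono hα).tendsto_atTop
  have hone : ∀ᶠ n in atTop,
      (∑ j ∈ Finset.range (blockEnd α n), (d j : ℝ)) / blockEnd α n = 1 := by
    filter_upwards [eventually_gt_atTop 0] with n hn
    have hpos : 0 < blockEnd α n := by simpa [blockEnd] using blockEnd_strictMono hα hn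
    have hsum : ∑ k ∈ Finset.range (blockEnd α n), (d k : ℕ) = blockEnd α n := by
      simpa [hu] using h.sum_range_blockEnd hα n
    rw [div_eq_one_iff_eq (by exact_mod_cast hpos.ne')]
    exact_mod_cast hsum
  have hmean_eq : ∑ i : Fin s, (i : ℝ) * (s : ℝ)⁻¹ = 1 :=
    tendsto_nhds_unique (hmean.congr' hone) tendsto_const_nhds
  rw [← Finset.sum_mul, mul_inv_eq_one₀ hs] at hmean_eq
  have hsum_digits : ∑ i ∈ Finset.range s, i = s := by
    rw [← Fin.sum_univ_eq_sum_range (fun i => i)]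
    exact_mod_cast hmean_eq
  have hgauss := Finset.sum_range_id_mul_two s
  rw [hsum_digits] at hgauss
  have := Nat.eq_of_mul_eq_mul_left (Fin.pos u) hgauss
  omega

end IsBlockConcat

lemma exists_isBlockConcat_of_mem {s : ℕ} {x : ℝ} (hx : x ∈ normalNumbers s ∩ S₀ s) :
    ∃ (u : Fin s) (α d : ℕ → Fin s), (u : ℕ) = 0 ∧ x ∈ S s u ∧ (∀ n, (α n : ℕ) ≠ 0) ∧
      IsBlockConcat u α d ∧ ∀ i, HasFrequency d i ((s : ℝ)⁻¹) := by
  obtain ⟨⟨-, d, hxd, hfreq⟩, hx₀⟩ := hx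
  obtain ⟨u, hxu⟩ := Set.mem_iUnion.mp hx₀
  obtain ⟨α, e, hα, hblock, hxe⟩ := id hxu
  have hs : 1 < s := (Nat.one_le_iff_ne_zero.mpr (hα 0).1).trans_lt (α 0).isLt
  obtain rfl := eq_of_ofDigits_eq_of_hasFrequency hs hfreq (hxd.symm.trans hxe)
  obtain ⟨k, hk⟩ := ((hfreq ⟨0, by omega⟩).frequently_eq (by positivity)).exists
  exact ⟨u, α, d, hblock.val_eq_zero (fun n => (hα n).1) (congrArg Fin.val hk), hxu,
    fun n => (hα n).1, hblock, hfreq⟩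

lemma normalNumbers_inter_S₀_eq_empty {s : ℕ} (hs : s ≠ 3) : normalNumbers s ∩ S₀ s = ∅ := by
  refine Set.eq_empty_of_forall_notMem fun x hx => hs ?_
  obtain ⟨u, α, d, hu, -, hα, hblock, hfreq⟩ := exists_isBlockConcat_of_mem hx
  exact hblock.eq_three_of_hasFrequency hα hu hfreq

lemma normalNumbers_inter_S₀_subset (s : ℕ) [NeZero s] : normalNumbers s ∩ S₀ s ⊆ S s 0 := by
  intro x hx
  obtain ⟨u, -, -, hu, hxu, -⟩ := exists_isBlockConcat_of_mem hx
  rwa [show u = 0 from Fin.ext hu] at hxu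

/-! ### Hausdorff dimension and codings by sequences -/

/-- The bound by the similarity dimension, as for the limit set of an iterated function system whose
maps contract by the factors `r i`. -/
lemma dimH_le_of_edist_le_prod {X ι : Type*} [EMetricSpace X] [Fintype ι] {E : Set X}
    (a : E → ℕ → ι) {r : ι → ENNReal} (hr : ∀ i, r i < 1)
    (hE : ∀ (x y : E) (n : ℕ), (∀ i < n, a x i = a y i) →
      edist x y ≤ ∏ i ∈ Finset.range n, r (a x i))
    {t : NNReal} (ht : ∑ i, r i ^ (t : ℝ) ≤ 1) : dimH E ≤ t := by
  borelize X
  let C (n : ℕ) (w : Fin n → ι) : Set X := {x | ∃ h : x ∈ E, ∀ i : Fin n, a ⟨x, h⟩ i = w i}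
  have hcover : ∀ n, E ⊆ ⋃ w, C n w := fun n x hx =>
    Set.mem_iUnion.mpr ⟨fun i => a ⟨x, hx⟩ i, hx, fun _ => rfl⟩
  have hdiam : ∀ n w, Metric.ediam (C n w) ≤ ∏ i, r (w i) := fun n w =>
    Metric.ediam_le fun x ⟨hx, hxw⟩ y ⟨hy, hyw⟩ => by
      refine (hE ⟨x, hx⟩ ⟨y, hy⟩ n fun i hi => ?_).trans_eq ?_
      · rw [hxw ⟨i, hi⟩, hyw ⟨i, hi⟩]
      · rw [Finset.prod_range]
        simp only [hxw]
  have hprod : ∀ n (w : Fin n → ι), ∏ i, r (w i) ≤ Finset.univ.sup r ^ n := fun n w => by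
    simpa using Finset.prod_le_pow_card Finset.univ (fun i => r (w i)) _
      fun i _ => Finset.le_sup (Finset.mem_univ (w i))
  have hsup : Finset.univ.sup r < 1 := (Finset.sup_lt_iff zero_lt_one).mpr fun i _ => hr i
  have hsum : ∀ n, ∑ w, Metric.ediam (C n w) ^ (t : ℝ) ≤ 1 := fun n =>
    calc ∑ w, Metric.ediam (C n w) ^ (t : ℝ)
        ≤ ∑ w : Fin n → ι, ∏ i, r (w i) ^ (t : ℝ) := Finset.sum_le_sum fun w _ => by
          rw [ENNReal.prod_rpow_of_nonneg t.coe_nonneg]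
          exact ENNReal.rpow_le_rpow (hdiam n w) t.coe_nonneg
      _ = (∑ i, r i ^ (t : ℝ)) ^ n := (Fintype.sum_pow (fun i => r i ^ (t : ℝ)) n).symm
      _ ≤ 1 := pow_le_one₀ zero_le ht
  have hmeasure := MeasureTheory.Measure.hausdorffMeasure_le_liminf_sum (t : ℝ) E _
    (ENNReal.tendsto_pow_atTop_nhds_zero_of_lt_one hsup) C
    (.of_forall fun n w => (hdiam n w).trans (hprod n w)) (.of_forall hcover)
  refine dimH_le_of_hausdorffMeasure_ne_top (ne_top_of_le_ne_top ENNReal.one_ne_top ?_)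
  exact (hmeasure.trans (liminf_le_liminf (.of_forall hsum))).trans_eq (liminf_const 1)

lemma mul_dimH_range_le_of_edist_le {X Y Z : Type*} [EMetricSpace X] [EMetricSpace Y]
    {f : Z → X} {g : Z → Y} {C t : NNReal}
    (h : ∀ x y, edist (f x) (f y) ≤ C * edist (g x) (g y) ^ (t : ℝ)) :
    t * dimH (Set.range f) ≤ dimH (Set.range g) := by
  rcases eq_zero_or_pos t with rfl | ht
  · simp
  cases isEmpty_or_nonempty Z
  · simp [Set.range_eq_empty]
  have : Nonempty X := Nonempty.map f inferInstance
  have hfactors : f.FactorsThrough g := fun x y hxy => edist_le_zero.mp <|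
    (h x y).trans_eq <| by
      rw [hxy, edist_self, ENNReal.zero_rpow_of_pos (NNReal.coe_pos.mpr ht), mul_zero]
  obtain ⟨k, rfl⟩ := (Function.factorsThrough_iff f).mp hfactors
  have hholder : HolderOnWith C t k (Set.range g) := by
    rintro _ ⟨x, rfl⟩ _ ⟨y, rfl⟩
    exact h x y
  rw [Set.range_comp, mul_comm]
  exact ENNReal.mul_le_of_le_div (hholder.dimH_image_le ht)

lemma dimH_range_ofDigits {b : ℕ} (hb : 1 < b) :
    dimH (Set.range (Real.ofDigits (b := b))) = 1 := by
  have hIcc : Set.Icc (0 : ℝ) 1 ⊆ Set.range (Real.ofDigits (b := b)) := fun y hy => by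
    obtain ⟨d, -, hd⟩ := Real.ofDigits_SurjOn hb hy
    exact ⟨d, hd⟩
  rw [Real.dimH_of_nonempty_interior, Module.finrank_self, Nat.cast_one]
  exact (Set.nonempty_Ioo.mpr zero_lt_one).mono (interior_Icc (a := (0 : ℝ)) ▸ interior_mono hIcc)

/-- A gap of `2` between the digits keeps the cylinders of order `n` at distance at least `b⁻ⁿ`. -/
lemma abs_ofDigits_sub_ofDigits_le_mul_rpow {N b : ℕ} (hb : 1 < b) {v : Fin N → Fin b}
    (hv : Pairwise fun i j => 2 ≤ |(v i : ℤ) - v j|) (x y : ℕ → Fin N) :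
    |Real.ofDigits x - Real.ofDigits y| ≤
      N * |Real.ofDigits (v ∘ x) - Real.ofDigits (v ∘ y)| ^ Real.logb b N := by
  rcases eq_or_ne x y with rfl | hne
  · rw [sub_self, abs_zero]
    positivity
  set n := PiNat.firstDiff x y
  have hlt : ∀ i < n, x i = y i := fun _ =>
    PiNat.apply_eq_of_lt_firstDiff (E := fun _ => Fin N)
  have hgap : (2 : ℝ) ≤ |((v ∘ x) n - (v ∘ y) n : ℝ)| := by
    exact_mod_cast hv (PiNat.apply_firstDiff_ne hne)
  have hsep : ((b : ℝ)⁻¹) ^ (n + 1) ≤ |Real.ofDigits (v ∘ x) - Real.ofDigits (v ∘ y)| := by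
    refine le_trans ?_ (abs_sub_sub_one_div_pow_le (d := v ∘ x) (e := v ∘ y)
      fun i hi => congrArg v (hlt i hi))
    rw [inv_pow, inv_eq_one_div]
    gcongr
    linarith
  have hb' : (1 : ℝ) < b := by exact_mod_cast hb
  have hN : 0 < N := Fin.pos (x 0)
  have ht : 0 ≤ Real.logb b N := Real.logb_nonneg hb' (by exact_mod_cast hN)
  have hbt : ((b : ℝ)⁻¹) ^ Real.logb b N = (N : ℝ)⁻¹ := by
    rw [Real.inv_rpow (by positivity),
      Real.rpow_logb (by positivity) hb'.ne' (by exact_mod_cast hN)]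
  calc |Real.ofDigits x - Real.ofDigits y| ≤ ((N : ℝ) ^ n)⁻¹ :=
        Real.abs_ofDigits_sub_ofDigits_le hlt
    _ = N * (((b : ℝ)⁻¹) ^ (n + 1)) ^ Real.logb b N := by
        rw [← Real.rpow_pow_comm (by positivity), hbt, inv_pow, pow_succ]
        field_simp
    _ ≤ _ := by gcongr

lemma logb_le_dimH_range_ofDigits_comp {N b : ℕ} (hN : 1 < N) {v : Fin N → Fin b}
    (hv : Pairwise fun i j => 2 ≤ |(v i : ℤ) - v j|) :
    ENNReal.ofReal (Real.logb b N) ≤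
      dimH (Set.range fun x : ℕ → Fin N => Real.ofDigits (v ∘ x)) := by
  have hv_inj : Function.Injective v := fun i j hij => by
    by_contra hne
    simpa [hij] using hv hne
  have hb : 1 < b := hN.trans_le (by simpa using Fintype.card_le_of_injective v hv_inj)
  have ht : 0 ≤ Real.logb b N :=
    Real.logb_nonneg (by exact_mod_cast hb) (by exact_mod_cast hN.le)
  have hdim := mul_dimH_range_le_of_edist_le (C := N) (t := (Real.logb b N).toNNReal)
    (f := Real.ofDigits (b := N)) (g := fun x : ℕ → Fin N => Real.ofDigits (v ∘ x)) fun x y => by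
      rw [edist_dist, edist_dist, Real.dist_eq, Real.dist_eq, Real.coe_toNNReal _ ht,
        ENNReal.ofReal_rpow_of_nonneg (abs_nonneg _) ht, ENNReal.coe_natCast,
        ← ENNReal.ofReal_natCast, ← ENNReal.ofReal_mul (by positivity)]
      exact ENNReal.ofReal_le_ofReal (abs_ofDigits_sub_ofDigits_le_mul_rpow hb hv x y)
  rwa [dimH_range_ofDigits hN, mul_one] at hdim

/-! ### The dimension of `S s u` -/

lemma dimH_S_le {s : ℕ} {u : Fin s} {t : ℝ} (ht₀ : 0 ≤ t)
    (ht : ∑ a ∈ {a : Fin s | (a : ℕ) ≠ 0 ∧ a ≠ u}, ((s : ℝ) ^ (-t)) ^ (a : ℕ) ≤ 1) :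
    dimH (S s u) ≤ ENNReal.ofReal t := by
  choose α d hα hblock hx using fun x : S s u => x.2
  have hs0 : (0 : ℝ) < s := by exact_mod_cast Fin.pos u
  let r (a : {a : Fin s // (a : ℕ) ≠ 0 ∧ a ≠ u}) : ENNReal :=
    ENNReal.ofReal ((s : ℝ)⁻¹ ^ (a : ℕ))
  refine dimH_le_of_edist_le_prod (fun x n => ⟨α x n, hα x n⟩) (r := r) (fun a => ?_)
    (fun x y n hxy => ?_) ?_
  · have hs : (1 : ℝ) < s := by
      exact_mod_cast (Nat.one_le_iff_ne_zero.mpr a.2.1).trans_lt a.1.isLt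
    exact ENNReal.ofReal_lt_one.mpr (pow_lt_one₀ (by positivity) (inv_lt_one_of_one_lt₀ hs) a.2.1)
  · have hαxy : ∀ i < n, α x i = α y i := fun i hi => congrArg Subtype.val (hxy i hi)
    have hdigits := (hblock x).apply_eq_of_lt_blockEnd (hblock y) (fun n => (hα x n).1)
      (fun n => (hα y n).1) hαxy
    rw [Subtype.edist_eq, hx x, hx y, edist_dist, Real.dist_eq,
      ← ENNReal.ofReal_prod_of_nonneg fun i _ => by positivity, Finset.prod_pow_eq_pow_sum, inv_pow]
    exact ENNReal.ofReal_le_ofReal (Real.abs_ofDigits_sub_ofDigits_le hdigits)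
  · have hterm : ∀ a, r a ^ t = ENNReal.ofReal (((s : ℝ) ^ (-t)) ^ (a : ℕ)) := fun a => by
      rw [ENNReal.ofReal_rpow_of_nonneg (by positivity) ht₀, ← Real.rpow_pow_comm (by positivity),
        Real.inv_rpow hs0.le, Real.rpow_neg hs0.le]
    rw [Real.coe_toNNReal t ht₀, Finset.sum_congr rfl fun a _ => hterm a,
      ← ENNReal.ofReal_sum_of_nonneg fun a _ => by positivity, ENNReal.ofReal_le_one]
    rwa [← Finset.subtype_univ,
      Finset.sum_subtype_eq_sum_filter fun a : Fin s => ((s : ℝ) ^ (-t)) ^ (a : ℕ)]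

open goldenRatio in
lemma dimH_S_three_zero_le : dimH (S 3 0) ≤ ENNReal.ofReal (Real.logb 3 φ) := by
  have hφ : (3 : ℝ) ^ (-Real.logb 3 φ) = φ⁻¹ := by
    rw [Real.rpow_neg (by norm_num),
      Real.rpow_logb (by norm_num) (by norm_num) Real.goldenRatio_pos]
  refine dimH_S_le (Real.logb_nonneg (by norm_num) Real.one_lt_goldenRatio.le) (le_of_eq ?_)
  have hsum : φ⁻¹ + φ⁻¹ ^ 2 = 1 := by
    rw [Real.inv_goldenRatio, neg_sq, Real.goldenConj_sq, neg_add_cancel_left]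
  simpa [Finset.sum_filter, Fin.sum_univ_three, hφ] using hsum

/-! ### Sequences assembled from words -/

/-- The concatenation `w 0 w 1 w 2 …` of words of the same length `m`. -/
def concatWords {β : Type*} {m : ℕ} [NeZero m] (w : ℕ → Fin m → β) (k : ℕ) : β :=
  Function.uncurry w (Nat.divModEquiv m k)

lemma exists_eq_mul_add_fin (m : ℕ) [NeZero m] (k : ℕ) : ∃ (n : ℕ) (j : Fin m), k = m * n + j :=
  ⟨k / m, Fin.ofNat m k, (Nat.div_add_mod k m).symm⟩

section ConcatWords

variable {β : Type*} {m : ℕ} [NeZero m]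

lemma concatWords_mul_add (w : ℕ → Fin m → β) (n : ℕ) (j : Fin m) :
    concatWords w (m * n + j) = w n j := by
  rw [mul_comm]
  exact congrArg (Function.uncurry w) ((Nat.divModEquiv m).apply_symm_apply (n, j))

lemma concatWords_injective : Function.Injective (concatWords (β := β) (m := m)) :=
  fun w w' h => funext₂ fun n j => by
    rw [← concatWords_mul_add w, h, concatWords_mul_add]

lemma sum_range_mul_concatWords {M : Type*} [AddCommMonoid M] (w : ℕ → Fin m → β) (f : β → M)
    (n : ℕ) : ∑ k ∈ Finset.range (m * n), f (concatWords w k) =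
      ∑ i ∈ Finset.range n, ∑ j, f (w i j) := by
  induction n with
  | zero => simp
  | succ n ih =>
    rw [Nat.mul_succ, Finset.sum_range_add, ih, Finset.sum_range_succ,
      Finset.sum_range fun k => f (concatWords w (m * n + k))]
    simp only [concatWords_mul_add]

lemma hasFrequency_concatWords {s c : ℕ} {w : ℕ → Fin m → Fin s} {i : Fin s}
    (h : ∀ n, (Finset.univ.filter fun j => w n j = i).card = c) :
    HasFrequency (concatWords w) i (c / m) := by
  refine hasFrequency_of_digitCount_mul (NeZero.pos m) fun n => ?_
  rw [digitCount, Finset.card_filter,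
    sum_range_mul_concatWords w (fun a => if a = i then 1 else 0)]
  simp only [← Finset.card_filter, h, Finset.sum_const, Finset.card_range, smul_eq_mul, mul_comm]

lemma blockEnd_concatWords {s l : ℕ} {L : ℕ → Fin m → Fin s} (hlen : ∀ n, ∑ j, (L n j : ℕ) = l)
    (n : ℕ) (j : Fin m) :
    blockEnd (concatWords L) (m * n + j + 1) = l * n + ∑ i ∈ Finset.Iic j, (L n i : ℕ) := by
  have hword : ∑ i ∈ Finset.range (j + 1), ((concatWords L (m * n + i) : Fin s) : ℕ) =
      ∑ i ∈ Finset.Iic j, (L n i : ℕ) := by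
    rw [Nat.range_succ_eq_Iic, ← Fin.map_valEmbedding_Iic, Finset.sum_map]
    simp only [Fin.valEmbedding_apply, concatWords_mul_add]
  rw [blockEnd, add_assoc, Finset.sum_range_add, hword,
    sum_range_mul_concatWords L fun a : Fin s => (a : ℕ), Finset.sum_congr rfl fun n _ => hlen n,
    Finset.sum_const, Finset.card_range, smul_eq_mul, mul_comm]

lemma isBlockConcat_concatWords {s p : ℕ} [NeZero p] {u : Fin s} {L : ℕ → Fin p → Fin s}
    {w : ℕ → Fin m → Fin s} (hL : ∀ n j, (L n j : ℕ) ≠ 0) (hlen : ∀ n, ∑ j, (L n j : ℕ) = m)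
    (hlast : ∀ n (k : Fin m) j, (k : ℕ) + 1 = ∑ i ∈ Finset.Iic j, (L n i : ℕ) → w n k = L n j)
    (hfill : ∀ n (k : Fin m), (∀ j, (k : ℕ) + 1 ≠ ∑ i ∈ Finset.Iic j, (L n i : ℕ)) → w n k = u) :
    IsBlockConcat u (concatWords L) (concatWords w) := by
  refine ⟨fun q k (hk : _ = blockEnd (concatWords L) (q + 1)) => ?_, fun k hk => ?_⟩
  · obtain ⟨n, j, rfl⟩ := exists_eq_mul_add_fin p q
    rw [blockEnd_concatWords hlen] at hk
    have hpos : 0 < ∑ i ∈ Finset.Iic j, (L n i : ℕ) :=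
      Finset.sum_pos (fun i _ => Nat.pos_of_ne_zero (hL n i)) ⟨j, Finset.mem_Iic.mpr le_rfl⟩
    have hle : ∑ i ∈ Finset.Iic j, (L n i : ℕ) ≤ m :=
      hlen n ▸ Finset.sum_le_univ_sum_of_nonneg fun _ => Nat.zero_le _
    obtain ⟨l, rfl⟩ := Nat.exists_eq_add_of_le (show m * n ≤ k by omega)
    rw [concatWords_mul_add L, ← hlast n ⟨l, by omega⟩ j (by dsimp only; omega)]
    exact concatWords_mul_add w n ⟨l, by omega⟩
  · obtain ⟨n, l, rfl⟩ := exists_eq_mul_add_fin m k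
    rw [concatWords_mul_add]
    refine hfill n l fun j hj => hk (p * n + j) ?_
    change _ = blockEnd (concatWords L) (p * n + j + 1)
    rw [blockEnd_concatWords hlen, add_assoc, hj]

/-- The base-`b` value of a word, its first letter being the most significant digit. -/
def wordValue {b m : ℕ} (w : Fin m → Fin b) : Fin (b ^ m) :=
  finFunctionFinEquiv (w ∘ Fin.rev)

lemma ofDigits_concatWords {b : ℕ} (w : ℕ → Fin m → Fin b) :
    Real.ofDigits (concatWords w) = Real.ofDigits fun n => wordValue (w n) := by
  have hb : (b : ℝ) ≠ 0 := by exact_mod_cast (Fin.pos (w 0 0)).ne'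
  have hterm : ∀ n, ∑ j : Fin m, Real.ofDigitsTerm (concatWords w) (n * m + j) =
      Real.ofDigitsTerm (fun n => wordValue (w n)) n := fun n => by
    rw [Real.ofDigitsTerm, wordValue, finFunctionFinEquiv_apply, Nat.cast_sum, Finset.sum_mul,
      ← Equiv.sum_comp Fin.revPerm]
    refine Finset.sum_congr rfl fun j _ => ?_
    have hpow : m * (n + 1) = n * m + (Fin.rev j : ℕ) + 1 + j := by
      rw [Fin.val_rev, Nat.mul_succ, mul_comm]
      omega
    rw [Real.ofDigitsTerm, Fin.revPerm_apply, mul_comm n, concatWords_mul_add, Function.comp_apply,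
      Nat.cast_mul, Nat.cast_pow, Nat.cast_pow, ← pow_mul, hpow, pow_add, mul_comm n]
    field_simp
    ring
  have hsummable : Summable fun q =>
      Real.ofDigitsTerm (concatWords w) ((Nat.divModEquiv m).symm q) :=
    (Nat.divModEquiv m).symm.summable_iff.mpr Real.summable_ofDigitsTerm
  rw [Real.ofDigits, ← (Nat.divModEquiv m).symm.tsum_eq, hsummable.tsum_prod, Real.ofDigits]
  exact tsum_congr fun n => (tsum_fintype _).trans (hterm n)

end ConcatWords

/-! ### Normal numbers in `S 3 0` -/

/-- Two words, each containing every ternary digit once, whose concatenations lie in `S 3 0`; they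
code normal numbers by binary sequences. -/
def codeWord : Fin 2 → Fin 3 → Fin 3 := ![![0, 2, 1], ![1, 0, 2]]

/-- The labels of the blocks `02`, `1` and `1`, `02` that make up the words `codeWord i`. -/
def codeLabel : Fin 2 → Fin 2 → Fin 3 := ![![2, 1], ![1, 2]]

/-- The number whose ternary expansion is the concatenation of the words `codeWord (x n)`. -/
noncomputable def decode (x : ℕ → Fin 2) : ℝ := Real.ofDigits (concatWords (codeWord ∘ x))

lemma hasFrequency_concatWords_codeWord (x : ℕ → Fin 2) (i : Fin 3) :
    HasFrequency (concatWords (codeWord ∘ x)) i (((3 : ℕ) : ℝ)⁻¹) := by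
  have hcount : ∀ a i, (Finset.univ.filter fun j => codeWord a j = i).card = 1 := by decide
  simpa using hasFrequency_concatWords (w := codeWord ∘ x) fun n => hcount (x n) i

lemma isBlockConcat_concatWords_codeWord (x : ℕ → Fin 2) :
    IsBlockConcat 0 (concatWords (codeLabel ∘ x)) (concatWords (codeWord ∘ x)) := by
  have hlabel : ∀ a j, (codeLabel a j : ℕ) ≠ 0 := by decide
  have hlen : ∀ a, ∑ j, (codeLabel a j : ℕ) = 3 := by decide
  have hlast : ∀ a (k : Fin 3) j, (k : ℕ) + 1 = ∑ i ∈ Finset.Iic j, (codeLabel a i : ℕ) →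
      codeWord a k = codeLabel a j := by decide
  have hfill : ∀ a (k : Fin 3), (∀ j, (k : ℕ) + 1 ≠ ∑ i ∈ Finset.Iic j, (codeLabel a i : ℕ)) →
      codeWord a k = 0 := by decide
  exact isBlockConcat_concatWords (fun n => hlabel (x n)) (fun n => hlen (x n))
    (fun n => hlast (x n)) (fun n => hfill (x n))

lemma decode_mem (x : ℕ → Fin 2) : decode x ∈ normalNumbers 3 ∩ S₀ 3 := by
  refine ⟨⟨⟨Real.ofDigits_nonneg _, Real.ofDigits_le_one _⟩, _, rfl,
    hasFrequency_concatWords_codeWord x⟩, Set.mem_iUnion.mpr ⟨0, _, _, fun k => ?_,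
    isBlockConcat_concatWords_codeWord x, rfl⟩⟩
  have hlabel : ∀ a j, (codeLabel a j : ℕ) ≠ 0 ∧ codeLabel a j ≠ 0 := by decide
  exact hlabel _ _

lemma decode_injective : Function.Injective decode := fun x y hxy => by
  have hword : Function.Injective codeWord := by decide
  exact hword.comp_left <| concatWords_injective <|
    eq_of_ofDigits_eq_of_hasFrequency (by norm_num) (hasFrequency_concatWords_codeWord x) hxy

lemma mk_normalNumbers_inter_S₀_three :
    Cardinal.mk ↥(normalNumbers 3 ∩ S₀ 3) = Cardinal.continuum := by
  refine le_antisymm ((Cardinal.mk_set_le _).trans_eq Cardinal.mk_real) ?_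
  calc Cardinal.continuum = Cardinal.mk (ℕ → Fin 2) := by simp
    _ = Cardinal.mk (Set.range decode) := (Cardinal.mk_range_eq decode decode_injective).symm
    _ ≤ Cardinal.mk ↥(normalNumbers 3 ∩ S₀ 3) :=
      Cardinal.mk_le_mk_of_subset (Set.range_subset_iff.mpr decode_mem)

lemma le_dimH_normalNumbers_inter_S₀_three :
    ENNReal.ofReal (1 / 3 * Real.logb 3 2) ≤ dimH (normalNumbers 3 ∩ S₀ 3) := by
  have hgap : Pairwise fun i j =>
      2 ≤ |(wordValue (codeWord i) : ℤ) - wordValue (codeWord j)| := by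
    unfold Pairwise
    decide
  have hlogb : Real.logb ((3 ^ 3 : ℕ) : ℝ) (2 : ℕ) = 1 / 3 * Real.logb 3 2 := by
    rw [Real.logb, Real.logb, Nat.cast_pow, Real.log_pow]
    push_cast
    ring
  rw [← hlogb]
  refine (logb_le_dimH_range_ofDigits_comp one_lt_two hgap).trans (dimH_mono ?_)
  rintro _ ⟨x, rfl⟩
  have hmem := decode_mem x
  rwa [decode, ofDigits_concatWords] at hmem

open goldenRatio in
lemma goldenRatio_eq_two_div_sqrt_five_sub_one : φ = 2 / (√5 - 1) := by
  have h5 : 1 < √5 := Real.lt_sqrt_of_sq_lt (by norm_num)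
  rw [Real.goldenRatio, eq_div_iff (by linarith)]
  linear_combination Real.sq_sqrt (show (0 : ℝ) ≤ 5 by norm_num) / 2

end SAdic

theorem theorem7 (s : ℕ) (hs : 2 < s) :
    (s = 3 →
      Cardinal.mk ↥(SAdic.normalNumbers 3 ∩ SAdic.S₀ 3) = Cardinal.continuum ∧
      SAdic.normalNumbers 3 ∩ SAdic.S₀ 3 ⊆ SAdic.S 3 0 ∧
      ENNReal.ofReal (1 / 3 * Real.logb 3 2) ≤ dimH (SAdic.normalNumbers 3 ∩ SAdic.S₀ 3) ∧
      dimH (SAdic.normalNumbers 3 ∩ SAdic.S₀ 3) ≤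
        ENNReal.ofReal (Real.logb 3 (2 / (Real.sqrt 5 - 1)))) ∧
    (s ≠ 3 → SAdic.normalNumbers s ∩ SAdic.S₀ s = ∅) := by
  have hsubset := SAdic.normalNumbers_inter_S₀_subset 3
  have hupper := (dimH_mono hsubset).trans SAdic.dimH_S_three_zero_le
  rw [SAdic.goldenRatio_eq_two_div_sqrt_five_sub_one] at hupper
  exact ⟨fun _ => ⟨SAdic.mk_normalNumbers_inter_S₀_three, hsubset,
    SAdic.le_dimH_normalNumbers_inter_S₀_three, hupper⟩, SAdic.normalNumbers_inter_S₀_eq_empty⟩
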